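/- Let $K$ be an arbitrary field of characteristic $p>0$, let $n\ge 0$, $P_n=K[x_1,\dots,x_n]$, and let $\mathcal D(P_n)\subseteq \mathrm{End}_K(P_n)$ be the ring of $K$-linear differential operators on $P_n$, with its canonical filtration $F_i=\bigoplus_{|\alpha|+|\beta|\le i}K\,x^\alpha\frac{\partial^\beta}{\beta!}$, $i\ge 0$, where $\frac{\partial^\beta}{\beta!}(x^\gamma)=\prod_j\binom{\gamma_j}{\beta_j}\,x^{\gamma-\beta}$. A finite dimensional filtration of $\mathcal D(P_n)$ is an ascending chain $\{F'_i\}_{i\ge0}$ of finite dimensional $K$-subspaces with $\bigcup_i F'_i=\mathcal D(P_n)$, $K\subseteq F'_0$ and $F'_iF'_j\subseteq F'_{i+j}$. It is equivalent to $F$ if there are natural numbers $a,c>0$ and $b,d\ge 0$ with $F'_i\subseteq F_{ai+b}$ and $F_i\subseteq F'_{ci+d}$ for all $i\gg0$, and strongly equivalent to $F$ if one can take $a=c=1$. A filtration of standard type on a finitely generated $\mathcal D(P_n)$-module $M$ is a filtration $\{M_i=F'_iM_0\}$ where $F'$ is a finite dimensional filtration of $\mathcal D(P_n)$ equivalent to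 $F$ and $M_0$ is a finite dimensional $K$-subspace with $M=\mathcal D(P_n)M_0$. The module $M$ is holonomic if, for some filtration of standard type $\{M_i\}$ on $M$, there is a polynomial $q\in\mathbb Q[t]$ of degree $n$ with $\dim_K M_i\le q(i)$ for all $i\gg0$ (the zero module is allowed, and for $n=0$ any constant $q$ is allowed). Theorem. Every holonomic $\mathcal D(P_n)$-module $M$ has finite length. Moreover, let $M_i=F'_iM_0$, where $F'$ is a finite dimensional filtration of $\mathcal D(P_n)$ strongly equivalent to the canonical filtration $F$ (for example $F'=F$) and $M_0$ is a finite dimensional subspace generating $M$, and let $l(M)$ be any real number with $$\dim_K M_i\le l(M)\,i^n+o(i^n),\qquad i\gg0 .$$ Then the length of $M$ does not exceed the multiplicity $n!\,l(M)$. -/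

import Mathlib

noncomputable section

namespace PolyDiffOp

/-! ### The ring of differential operators of a commutative algebra -/

section DiffOp

variable (R A : Type*) [CommRing R] [CommRing A] [Algebra R A]

/-- The map `f ↦ f x - x f` on `End_R(A)`, where `x ∈ A` acts on `A` by multiplication. -/
def commMul (x : A) : Module.End R A →ₗ[R] Module.End R A :=
  LinearMap.mulRight R (LinearMap.mulLeft R x) - LinearMap.mulLeft R (LinearMap.mulLeft R x)

variable {R A} in
theorem commMul_apply (x : A) (f : Module.End R A) :
    commMul R A x f = f * LinearMap.mulLeft R x - LinearMap.mulLeft R x * f := rfl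

/-- The order filtration: `D(A)_0 = End_A(A)` consists of the endomorphisms that commute with
all multiplications, and `D(A)_{i+1} = {f : f x - x f ∈ D(A)_i for all x ∈ A}`. -/
def diffOpOrder : ℕ → Submodule R (Module.End R A)
  | 0 => ⨅ x : A, LinearMap.ker (commMul R A x)
  | i + 1 => ⨅ x : A, (diffOpOrder i).comap (commMul R A x)

variable {R A}

theorem mem_diffOpOrder_zero {f : Module.End R A} :
    f ∈ diffOpOrder R A 0 ↔ ∀ x : A, commMul R A x f = 0 := by
  simp [diffOpOrder]

theorem mem_diffOpOrder_succ {i : ℕ} {f : Module.End R A} :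
    f ∈ diffOpOrder R A (i + 1) ↔ ∀ x : A, commMul R A x f ∈ diffOpOrder R A i := by
  simp [diffOpOrder]

theorem diffOpOrder_le_succ (i : ℕ) : diffOpOrder R A i ≤ diffOpOrder R A (i + 1) := by
  induction i with
  | zero =>
    intro f hf
    rw [mem_diffOpOrder_succ]
    intro x
    rw [mem_diffOpOrder_zero.1 hf x]
    exact zero_mem _
  | succ i ih =>
    intro f hf
    rw [mem_diffOpOrder_succ] at hf ⊢
    exact fun x => ih (hf x)

theorem diffOpOrder_mono : Monotone (diffOpOrder R A) := monotone_nat_of_le_succ diffOpOrder_le_succ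

theorem commMul_mul (x : A) (f g : Module.End R A) :
    commMul R A x (f * g) = f * commMul R A x g + commMul R A x f * g := by
  simp only [commMul_apply, mul_sub, sub_mul, mul_assoc]
  abel

theorem mulLeft_mem_diffOpOrder (a : A) : LinearMap.mulLeft R a ∈ diffOpOrder R A 0 := by
  rw [mem_diffOpOrder_zero]
  intro x
  ext y
  simp [commMul_apply, mul_left_comm]

theorem mul_mem_diffOpOrder : ∀ (k i j : ℕ) (f g : Module.End R A), i + j = k →
    f ∈ diffOpOrder R A i → g ∈ diffOpOrder R A j → f * g ∈ diffOpOrder R A k := by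
  intro k
  induction k with
  | zero =>
    intro i j f g h hf hg
    obtain ⟨rfl, rfl⟩ : i = 0 ∧ j = 0 := by omega
    rw [mem_diffOpOrder_zero] at hf hg ⊢
    intro x
    rw [commMul_mul, hf, hg, mul_zero, zero_mul, add_zero]
  | succ k ih =>
    intro i j f g h hf hg
    rw [mem_diffOpOrder_succ]
    intro x
    rw [commMul_mul]
    refine add_mem ?_ ?_
    · cases j with
      | zero => rw [mem_diffOpOrder_zero.1 hg x, mul_zero]; exact zero_mem _
      | succ j => exact ih i j _ _ (by omega) hf (mem_diffOpOrder_succ.1 hg x)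
    · cases i with
      | zero => rw [mem_diffOpOrder_zero.1 hf x, zero_mul]; exact zero_mem _
      | succ i => exact ih i j _ _ (by omega) (mem_diffOpOrder_succ.1 hf x) hg

variable (R A) in
/-- The ring `D(A) = ⋃ i, D(A)_i ⊆ End_R(A)` of `R`-linear differential operators on `A`. -/
def diffOp : Subalgebra R (Module.End R A) where
  carrier := {f | ∃ i, f ∈ diffOpOrder R A i}
  mul_mem' := by
    rintro f g ⟨i, hi⟩ ⟨j, hj⟩
    exact ⟨i + j, mul_mem_diffOpOrder _ i j f g rfl hi hj⟩
  add_mem' := by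
    rintro f g ⟨i, hi⟩ ⟨j, hj⟩
    exact ⟨max i j, add_mem (diffOpOrder_mono (le_max_left i j) hi)
      (diffOpOrder_mono (le_max_right i j) hj)⟩
  algebraMap_mem' := by
    intro r
    refine ⟨0, mem_diffOpOrder_zero.2 fun x => ?_⟩
    ext y
    simp [commMul_apply]

theorem mem_diffOp {f : Module.End R A} : f ∈ diffOp R A ↔ ∃ i, f ∈ diffOpOrder R A i := Iff.rfl

end DiffOp

/-! ### Filtrations -/

section Filtration

variable {K A : Type*} [Field K] [Ring A] [Algebra K A]

/-- `F` is a finite dimensional filtration of the `K`-algebra `A`: an ascending chain of finite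
dimensional subspaces with union `A`, with `K ⊆ F_0` and `F_i F_j ⊆ F_{i+j}`. -/
structure IsFiniteFiltration (F : ℕ → Submodule K A) : Prop where
  mono : Monotone F
  exhaustive : ∀ a : A, ∃ i, a ∈ F i
  one_mem : (1 : A) ∈ F 0
  mul_mem : ∀ (i j : ℕ) (a b : A), a ∈ F i → b ∈ F j → a * b ∈ F (i + j)
  finite : ∀ i, Module.Finite K (F i)

/-- Equivalence of filtrations. -/
def FiltrationEquiv (F G : ℕ → Submodule K A) : Prop :=
  ∃ a b c d : ℕ, 0 < a ∧ 0 < c ∧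
    ∀ᶠ i in Filter.atTop, F i ≤ G (a * i + b) ∧ G i ≤ F (c * i + d)

/-- Strong equivalence of filtrations. -/
def FiltrationStrongEquiv (F G : ℕ → Submodule K A) : Prop :=
  ∃ b d : ℕ, ∀ᶠ i in Filter.atTop, F i ≤ G (i + b) ∧ G i ≤ F (i + d)

variable {M : Type*} [AddCommGroup M] [Module K M] [Module A M]

/-- The filtration `M_i = F_i M_0` of a module attached to a filtration `F` of the algebra and a
subspace `M_0` of the module. -/
def moduleFiltration (F : ℕ → Submodule K A) (M₀ : Submodule K M) (i : ℕ) : Submodule K M :=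
  Submodule.span K {v | ∃ a ∈ F i, ∃ m ∈ M₀, v = a • m}

variable (A) in
/-- `M_0` is a finite dimensional subspace that generates `M` as an `A`-module. -/
def IsFiniteGenerating (M₀ : Submodule K M) : Prop :=
  Module.Finite K M₀ ∧ Submodule.span A (M₀ : Set M) = ⊤

end Filtration

/-! ### The ring `D(P_n)` and its canonical filtration -/

section Poly

variable (K : Type*) [Field K] (n : ℕ)

/-- The ring `D(P_n)` of differential operators on `P_n = K[x_1, …, x_n]`. -/
abbrev DP : Subalgebra K (Module.End K (MvPolynomial (Fin n) K)) :=
  diffOp K (MvPolynomial (Fin n) K)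

variable {n}

/-- The higher derivation `∂^β / β!` of `P_n`, given on monomials by
`x^γ ↦ (∏ i, binom(γ_i, β_i)) x^(γ - β)`. -/
def divDeriv (β : Fin n →₀ ℕ) : Module.End K (MvPolynomial (Fin n) K) :=
  (MvPolynomial.basisMonomials (Fin n) K).constr K fun γ =>
    MvPolynomial.monomial (γ - β) (∏ i, ((γ i).choose (β i) : K))

variable {K}

theorem divDeriv_monomial (β γ : Fin n →₀ ℕ) (c : K) :
    divDeriv K β (MvPolynomial.monomial γ c) =
      MvPolynomial.monomial (γ - β) (c * ∏ i, ((γ i).choose (β i) : K)) := by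
  have h : MvPolynomial.monomial γ c = c • (MvPolynomial.basisMonomials (Fin n) K) γ := by
    simp [MvPolynomial.smul_monomial]
  rw [h, map_smul, divDeriv, Module.Basis.constr_basis, MvPolynomial.smul_monomial, smul_eq_mul]

/-- The commutator of `∂^β / β!` with `x_j`. -/
theorem commMul_X_divDeriv (j : Fin n) (β : Fin n →₀ ℕ) :
    commMul K _ (MvPolynomial.X j) (divDeriv K β) =
      if β j = 0 then 0 else divDeriv K (β - Finsupp.single j 1) := by
  classical
  refine (MvPolynomial.basisMonomials (Fin n) K).ext fun γ => ?_
  have key : commMul K _ (MvPolynomial.X j) (divDeriv K β) (MvPolynomial.monomial γ 1) =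
      MvPolynomial.monomial (γ + Finsupp.single j 1 - β)
        (∏ i, (((γ + Finsupp.single j 1 : Fin n →₀ ℕ) i).choose (β i) : K)) -
      MvPolynomial.monomial (γ - β + Finsupp.single j 1) (∏ i, ((γ i).choose (β i) : K)) := by
    simp [commMul_apply, divDeriv_monomial, MvPolynomial.X, MvPolynomial.monomial_mul, add_comm]
  rw [MvPolynomial.coe_basisMonomials, key]
  split_ifs with hβ
  · have h1 : γ + Finsupp.single j 1 - β = γ - β + Finsupp.single j 1 := by
      ext i
      by_cases hi : j = i
      · subst hi; simp [hβ]
      · simp [hi]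
    have h2 : ∀ i, ((γ + Finsupp.single j 1 : Fin n →₀ ℕ) i).choose (β i) = (γ i).choose (β i) := by
      intro i
      by_cases hi : j = i
      · subst hi; simp [hβ]
      · simp [hi]
    simp only [h1, h2, sub_self, LinearMap.zero_apply]
  · obtain ⟨b, hb⟩ := Nat.exists_eq_succ_of_ne_zero hβ
    have h1 : γ + Finsupp.single j 1 - β = γ - (β - Finsupp.single j 1) := by
      ext i
      by_cases hi : j = i
      · subst hi; simp [hb]
      · simp [hi]
    have h3 : MvPolynomial.monomial (γ - β + Finsupp.single j 1)
          (∏ i, ((γ i).choose (β i) : K)) =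
        MvPolynomial.monomial (γ - (β - Finsupp.single j 1)) (∏ i, ((γ i).choose (β i) : K)) := by
      by_cases hlt : γ j < β j
      · have h0 : (∏ i, ((γ i).choose (β i) : K)) = 0 :=
          Finset.prod_eq_zero (Finset.mem_univ j) (by rw [Nat.choose_eq_zero_of_lt hlt]; simp)
        rw [h0, map_zero, map_zero]
      · have h4 : γ - β + Finsupp.single j 1 = γ - (β - Finsupp.single j 1) := ?_
        · rw [h4]
        ext i
        by_cases hi : j = i
        · subst hi
          simp only [Finsupp.coe_add, Finsupp.coe_tsub, Pi.add_apply, Pi.sub_apply,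
            Finsupp.single_eq_same]
          omega
        · simp [hi]
    rw [h1, h3, ← map_sub, divDeriv_monomial, one_mul]
    congr 1
    rw [← Finset.mul_prod_erase _ _ (Finset.mem_univ j),
      ← Finset.mul_prod_erase _ (fun i => ((γ i).choose (β i) : K)) (Finset.mem_univ j),
      ← Finset.mul_prod_erase _ (fun i => ((γ i).choose ((β - Finsupp.single j 1 : Fin n →₀ ℕ) i) : K))
        (Finset.mem_univ j)]
    have e1 : ∏ i ∈ Finset.univ.erase j, (((γ + Finsupp.single j 1 : Fin n →₀ ℕ) i).choose (β i) : K) =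
        ∏ i ∈ Finset.univ.erase j, ((γ i).choose (β i) : K) :=
      Finset.prod_congr rfl fun i hi => by
        simp [(Finset.ne_of_mem_erase hi).symm]
    have e2 : ∏ i ∈ Finset.univ.erase j, ((γ i).choose ((β - Finsupp.single j 1 : Fin n →₀ ℕ) i) : K) =
        ∏ i ∈ Finset.univ.erase j, ((γ i).choose (β i) : K) :=
      Finset.prod_congr rfl fun i hi => by
        simp [(Finset.ne_of_mem_erase hi).symm]
    rw [e1, e2, ← sub_mul]
    congr 1
    simp [hb, Nat.choose_succ_succ]

theorem commMul_C (c : K) (f : Module.End K (MvPolynomial (Fin n) K)) :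
    commMul K _ (MvPolynomial.C c) f = 0 := by
  refine LinearMap.ext fun y => ?_
  simp [commMul_apply, ← MvPolynomial.smul_eq_C_mul]

theorem commMul_mul_left {A : Type*} [CommRing A] [Algebra K A] (x y : A) (f : Module.End K A) :
    commMul K A (x * y) f =
      commMul K A x f * LinearMap.mulLeft K y + LinearMap.mulLeft K x * commMul K A y f := by
  ext z
  simp [commMul_apply, mul_sub]

/-- To have order at most `i + 1`, it suffices that the commutators with the variables have order
at most `i`. -/
theorem mem_diffOpOrder_of_X {i : ℕ} {f : Module.End K (MvPolynomial (Fin n) K)}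
    (h : ∀ j, commMul K _ (MvPolynomial.X j) f ∈ diffOpOrder K _ i) (x : MvPolynomial (Fin n) K) :
    commMul K _ x f ∈ diffOpOrder K _ i := by
  induction x using MvPolynomial.induction_on with
  | C c => rw [commMul_C]; exact zero_mem _
  | add x y hx hy =>
    have : commMul K _ (x + y) f = commMul K _ x f + commMul K _ y f := by
      refine LinearMap.ext fun z => ?_
      simp only [commMul_apply, LinearMap.sub_apply, Module.End.mul_apply, LinearMap.mulLeft_apply,
        LinearMap.add_apply, add_mul, map_add]
      abel
    rw [this]
    exact add_mem hx hy
  | mul_X x j hx =>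
    rw [commMul_mul_left]
    exact add_mem (mul_mem_diffOpOrder _ i 0 _ _ (by omega) hx (mulLeft_mem_diffOpOrder _))
      (mul_mem_diffOpOrder _ 0 i _ _ (by omega) (mulLeft_mem_diffOpOrder _) (h j))

theorem divDeriv_mem (β : Fin n →₀ ℕ) : divDeriv K β ∈ DP K n := by
  suffices h : ∀ (k : ℕ) (β : Fin n →₀ ℕ), β.degree ≤ k → divDeriv K β ∈ diffOpOrder K _ k from
    ⟨_, h _ β le_rfl⟩
  intro k
  induction k with
  | zero =>
    intro β hβ
    have h0 : β = 0 := (Finsupp.degree_eq_zero_iff β).1 (by omega)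
    have h1 : divDeriv K (0 : Fin n →₀ ℕ) = 1 := by
      refine (MvPolynomial.basisMonomials (Fin n) K).ext fun γ => ?_
      rw [MvPolynomial.coe_basisMonomials, divDeriv_monomial]
      simp
    rw [h0, h1, mem_diffOpOrder_zero]
    intro x
    rw [commMul_apply, one_mul, mul_one, sub_self]
  | succ k ih =>
    intro β hβ
    rw [mem_diffOpOrder_succ]
    refine mem_diffOpOrder_of_X fun j => ?_
    rw [commMul_X_divDeriv]
    split_ifs with hj
    · exact zero_mem _
    · refine ih _ ?_
      have hle : Finsupp.single j 1 ≤ β := Finsupp.single_le_iff.2 (Nat.one_le_iff_ne_zero.2 hj)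
      have := congrArg Finsupp.degree (tsub_add_cancel_of_le hle)
      rw [map_add, Finsupp.degree_single] at this
      omega

variable (K) in
/-- The operator `x^α ∂^β / β!` as an element of `D(P_n)`. -/
def basicOp (α β : Fin n →₀ ℕ) : DP K n :=
  ⟨LinearMap.mulLeft K (MvPolynomial.monomial α 1) * divDeriv K β,
    mul_mem ⟨0, mulLeft_mem_diffOpOrder _⟩ (divDeriv_mem β)⟩

variable (K n) in
/-- The canonical filtration `F_i = ⨁_{|α| + |β| ≤ i} K x^α ∂^β / β!` of `D(P_n)`. -/
def canonicalFiltration (i : ℕ) : Submodule K (DP K n) :=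
  Submodule.span K {d | ∃ α β : Fin n →₀ ℕ, α.degree + β.degree ≤ i ∧ d = basicOp K α β}

variable (K n) in
/-- A filtration of standard type of `D(P_n)`: a finite dimensional filtration equivalent to the
canonical one. -/
def IsStandardType (F : ℕ → Submodule K (DP K n)) : Prop :=
  IsFiniteFiltration (A := DP K n) F ∧ FiltrationEquiv (A := DP K n) F (canonicalFiltration K n)

variable (K n) in
/-- A (finitely generated) `D(P_n)`-module `M` is holonomic if, for some filtration of standard
type `{M_i}` of `M`, the function `i ↦ dim_K M_i` has polynomial growth of degree `n`. -/
def IsHolonomic (M : Type*) [AddCommGroup M] [Module K M] [Module (DP K n) M] : Prop :=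
  ∃ (F : ℕ → Submodule K (DP K n)) (M₀ : Submodule K M),
    IsStandardType K n F ∧ IsFiniteGenerating (DP K n) M₀ ∧
      ∃ q : Polynomial ℚ, q.natDegree = n ∧
        ∀ᶠ i : ℕ in Filter.atTop,
          (Module.finrank K (moduleFiltration (A := DP K n) F M₀ i) : ℚ) ≤ q.eval (i : ℚ)

end Poly

/-- `f(i) ≤ l i^n + o(i^n)` for `i ≫ 0`. -/
def HasLeadingBound (f : ℕ → ℕ) (n : ℕ) (l : ℝ) : Prop :=
  ∃ g : ℕ → ℝ, g =o[Filter.atTop] (fun i : ℕ => (i : ℝ) ^ n) ∧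
    ∀ᶠ i : ℕ in Filter.atTop, (f i : ℝ) ≤ l * (i : ℝ) ^ n + g i

end PolyDiffOp

end

/-! The theorem is a counting argument resting on Bernstein's inequality: a nonzero vector `m` of a
module, hit by operators of canonical degree at most `i + e`, yields at least `(i + n).choose n`
linearly independent vectors, with `e` independent of `i` (`exists_growth`). Given a chain of `r`
strict inclusions, apply this to a vector of each step modulo the previous submodule. The results
are jointly independent (`hasIndep_of_ltSeries`), so `dim M_i` grows at least like `r * i ^ n / n!`.
Comparing with the upper bound limits `r` (`ltSeries_length_le`).

Bernstein's inequality is proved by induction on the number of variables, for any operators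
satisfying the commutation relations of variables and divided powers `D_k`, over an algebraically
closed field. Let `x` be the last variable. If `m` is torsion over `K[x]`, a multiple of it is an
eigenvector of `x`, with eigenvalue `c`. The other operators act on `N = ker (x - c)`, and the sum
of the spaces `D_k N` is direct because `x - c` sends `D_(k+1) v` to `-D_k v`. If `m` is torsion
free, extend scalars to an algebraic closure of `K(x)`. Independent vectors there lift to vectors
independent over `K[x]`, and the powers of `x` supply the missing dimension. Both cases add up the
counts for `i - k`, `k ≤ i`, by the hockey-stick identity. -/

noncomputable section

namespace PolyDiffOp

open Polynomial TensorProduct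

universe u v

/-! ### Words of bounded weight -/

section Reach

variable {ι M : Type*} (T : ι → M → M) (wt : ι → ℕ) (m : M)

/-- `Reach T wt m i v` says that `v` is obtained from `m` by applying a word in the operators `T`
of total weight at most `i`. -/
inductive Reach : ℕ → M → Prop
  | base (i : ℕ) : Reach i m
  | step {i i' : ℕ} {v : M} (j : ι) : Reach i v → i + wt j ≤ i' → Reach i' (T j v)

variable {T wt m}

theorem Reach.mono {i j : ℕ} {v : M} (h : Reach T wt m i v) (hij : i ≤ j) : Reach T wt m j v := by
  cases h with
  | base => exact .base j
  | step k hv hk => exact .step k hv (hk.trans hij)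

theorem Reach.map {κ N : Type*} {U : κ → N → N} {wu : κ → ℕ} (φ : M → N) (e : ι → κ)
    (hφ : ∀ j v, φ (T j v) = U (e j) (φ v)) (he : ∀ j, wu (e j) = wt j) {i : ℕ} {v : M}
    (h : Reach T wt m i v) : Reach U wu (φ m) i (φ v) := by
  induction h with
  | base i => exact .base i
  | step j _ hj ih =>
    rw [hφ]
    exact .step _ ih (by rwa [he])

/-- Replay the same word on `m`. This brings words in an extension of scalars back to the original
space. -/
theorem Reach.exists_lift {N : Type*} {U : ι → N → N} (φ : M → N)
    (hφ : ∀ j v, φ (T j v) = U j (φ v)) {i : ℕ} {w : N} (h : Reach U wt (φ m) i w) :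
    ∃ v, Reach T wt m i v ∧ φ v = w := by
  induction h with
  | base i => exact ⟨m, .base i, rfl⟩
  | step j _ hj ih =>
    obtain ⟨v, hv, rfl⟩ := ih
    exact ⟨_, .step j hv hj, hφ j v⟩

variable (T wt m) in
/-- The vectors obtained from `m` by words of weight at most `i`. -/
def reachSet (i : ℕ) : Set M := {v | Reach T wt m i v}

theorem reachSet_mono : Monotone (reachSet T wt m) := fun _ _ hij _ hv => Reach.mono hv hij

/-- Concatenating words adds weights. Hence replacing `m` by a multiple costs only a constant shift.
-/
theorem mem_span_reachSet_trans {K V : Type*} [Field K] [AddCommGroup V] [Module K V]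
    {T : ι → Module.End K V} {m m' : V} {e : ℕ}
    (hm' : m' ∈ Submodule.span K (reachSet (fun j => T j) wt m e)) {i : ℕ} {v : V}
    (hv : v ∈ Submodule.span K (reachSet (fun j => T j) wt m' i)) :
    v ∈ Submodule.span K (reachSet (fun j => T j) wt m (i + e)) := by
  refine Submodule.span_le.2 (fun w hw => ?_) hv
  clear hv
  change Reach _ _ _ _ _ at hw
  induction hw with
  | base i => exact Submodule.span_mono (reachSet_mono (by omega)) hm'
  | @step i i' v j _ hj ih =>
    have h1 := Submodule.mem_map_of_mem (f := T j) (ih)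
    rw [Submodule.map_span] at h1
    refine Submodule.span_mono ?_ h1
    rintro _ ⟨w, hw, rfl⟩
    exact Reach.step j hw (by omega)

end Reach

/-! ### Bases adapted to a chain of spanning sets -/

section AdaptedBasis

variable {K V : Type*} [DivisionRing K] [AddCommGroup V] [Module K V]

/-- An ascending chain of sets contains bases of their spans with independent union. -/
theorem exists_adapted_basis (S : ℕ → Set V) (hS : Monotone S) :
    ∃ B : ℕ → Set V, (∀ i, B i ⊆ S i) ∧ (∀ i, S i ⊆ Submodule.span K (B i)) ∧
      LinearIndepOn K id (⋃ i, B i) := by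
  have h0 : ∃ b : Set V, b ⊆ S 0 ∧ S 0 ⊆ Submodule.span K b ∧ LinearIndepOn K id b := by
    obtain ⟨b, h1, -, h3, h4⟩ := exists_linearIndepOn_id_extension
      (linearIndepOn_empty K (id : V → V)) (Set.empty_subset (S 0))
    exact ⟨b, h1, h3, h4⟩
  have hs : ∀ (i : ℕ) (b : {b : Set V // b ⊆ S i ∧ S i ⊆ Submodule.span K b ∧
      LinearIndepOn K id b}), ∃ b' : {b : Set V // b ⊆ S (i + 1) ∧
      S (i + 1) ⊆ Submodule.span K b ∧ LinearIndepOn K id b}, b.1 ⊆ b'.1 := by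
    rintro i ⟨b, hb1, -, hb3⟩
    obtain ⟨b', h1, h2, h3, h4⟩ := exists_linearIndepOn_id_extension hb3
      (hb1.trans (hS i.le_succ))
    exact ⟨⟨b', h1, h3, h4⟩, h2⟩
  choose f hf using hs
  let B : (i : ℕ) → {b : Set V // b ⊆ S i ∧ S i ⊆ Submodule.span K b ∧ LinearIndepOn K id b} :=
    fun i => Nat.rec ⟨h0.choose, h0.choose_spec⟩ (fun i b => f i b) i
  have hB : Monotone fun i => (B i).1 := monotone_nat_of_le_succ fun i => hf i (B i)
  exact ⟨fun i => (B i).1, fun i => (B i).2.1, fun i => (B i).2.2.1,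
    linearIndepOn_iUnion_of_directed hB.directed_le fun i => (B i).2.2.2⟩

/-- The span of `B` has dimension `#B`, so `N ≤ #B`. This trades arbitrary independent vectors for
members of an adapted basis, which come from single words and are independent across all levels. -/
theorem exists_injective_of_span {S B : Set V} (hSB : S ⊆ Submodule.span K B)
    (hB : LinearIndepOn K id B) {N : ℕ} {w : Fin N → V} (hw : LinearIndependent K w)
    (hwS : ∀ a, w a ∈ Submodule.span K S) : ∃ b : Fin N → V, Function.Injective b ∧ ∀ a, b a ∈ B := by
  have hle : Submodule.span K S ≤ Submodule.span K B := Submodule.span_le.2 hSB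
  have h1 : LinearIndependent K (fun a => (⟨w a, hle (hwS a)⟩ : Submodule.span K B)) :=
    LinearIndependent.of_comp (Submodule.span K B).subtype hw
  have h2 := h1.cardinal_lift_le_rank
  rw [rank_span_set hB] at h2
  have h3 : Cardinal.lift (Cardinal.mk (Fin N)) ≤ Cardinal.lift (Cardinal.mk B) := h2
  obtain ⟨g⟩ := Cardinal.lift_mk_le'.1 h3
  exact ⟨fun a => g a, fun a b hab => g.injective (Subtype.ext hab), fun a => (g a).2⟩

end AdaptedBasis

/-! ### Divided power actions and the two inductive steps -/

/-- The relations between multiplications by the variables (`T (j, none)`) and divided powers of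
the partial derivatives (`T (j, some k)`) that govern the growth of a module. -/
structure IsDividedPowerAction {A : Type*} [Semiring A] {n : ℕ} (T : Fin n × Option ℕ → A) :
    Prop where
  commute : ∀ i j a, i ≠ j → Commute (T (i, a)) (T (j, none))
  zero : ∀ i, T (i, some 0) = 1
  succ : ∀ i k, T (i, some (k + 1)) * T (i, none) = T (i, none) * T (i, some (k + 1)) + T (i, some k)

/-- The weight of a variable is one, that of a `k`-th divided power is `k`. -/
def opWeight {n : ℕ} (j : Fin n × Option ℕ) : ℕ := j.2.elim 1 id

/-- The span of the vectors obtained from `m` by words of weight at most `i`. -/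
abbrev reachSpan {K V : Type*} [Field K] [AddCommGroup V] [Module K V] {n : ℕ}
    (T : Fin n × Option ℕ → Module.End K V) (m : V) (i : ℕ) : Submodule K V :=
  Submodule.span K (reachSet (fun j => T j) opWeight m i)

/-- The vector space `W` has at least `N` linearly independent vectors. -/
def HasIndep (K : Type*) {V : Type*} [Field K] [AddCommGroup V] [Module K V] (W : Submodule K V)
    (N : ℕ) : Prop :=
  ∃ w : Fin N → V, LinearIndependent K w ∧ ∀ a, w a ∈ W

/-- The first `n` coordinates of an action of `n + 1` coordinates. -/
def initOps {n : ℕ} {E : Type*} (T : Fin (n + 1) × Option ℕ → E) : Fin n × Option ℕ → E :=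
  fun j => T (j.1.castSucc, j.2)

theorem sum_choose_shift (n i : ℕ) :
    ∑ k ∈ Finset.range (i + 1), (i - k + n).choose n = (i + (n + 1)).choose (n + 1) := by
  rw [← add_assoc, ← Nat.sum_range_add_choose i n, ← Finset.sum_range_reflect]
  refine Finset.sum_congr rfl fun k hk => ?_
  have := Finset.mem_range.1 hk
  congr 2
  omega

/-- The target of both inductive steps: `k` is the weight spent on the last coordinate, and `i - k`
remains for the others. -/
theorem hasIndep_of_sigma {K V : Type*} [Field K] [AddCommGroup V] [Module K V]
    {W : Submodule K V} {n i : ℕ}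
    (w : (Σ k : Fin (i + 1), Fin ((i - k + n).choose n)) → V) (hw : LinearIndependent K w)
    (hwW : ∀ a, w a ∈ W) : HasIndep K W ((i + (n + 1)).choose (n + 1)) := by
  have hc : Fintype.card (Σ k : Fin (i + 1), Fin ((i - k + n).choose n)) =
      (i + (n + 1)).choose (n + 1) := by
    rw [Fintype.card_sigma, ← sum_choose_shift, Finset.sum_range]
    simp
  let e := (Fintype.equivFinOfCardEq hc).symm
  exact ⟨w ∘ e, hw.comp e e.injective, fun a => hwW _⟩

/-- Divided powers of the last derivative are independent over the kernel of the last variable. -/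
theorem injective_sum_dividedPowers {K V : Type*} [Field K] [AddCommGroup V] [Module K V]
    {x : Module.End K V} {D : ℕ → Module.End K V} (h0 : D 0 = 1)
    (hs : ∀ k, D (k + 1) * x = x * D (k + 1) + D k) (c : K) :
    Function.Injective (Finsupp.lsum K fun k =>
      (D k).comp (LinearMap.ker (x - algebraMap K _ c)).subtype) := by
  set N := LinearMap.ker (x - algebraMap K (Module.End K V) c) with hN
  have hx : ∀ v : N, x v.1 = c • v.1 := fun v => by
    have := LinearMap.mem_ker.1 v.2
    rwa [LinearMap.sub_apply, sub_eq_zero] at this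
  have hk0 : ∀ v : N, (x - algebraMap K (Module.End K V) c) (D 0 v.1) = 0 := fun v => by
    simp [h0]
  -- On `N` the relation reads `c D_(k+1) v = x D_(k+1) v + D_k v`. No factor `k + 1` appears, so
  -- nothing vanishes in positive characteristic.
  have hks : ∀ k (v : N), (x - algebraMap K (Module.End K V) c) (D (k + 1) v.1) = - D k v.1 := by
    intro k v
    have := LinearMap.congr_fun (hs k) v.1
    simp only [Module.End.mul_apply, LinearMap.add_apply, hx, map_smul] at this
    simp [this]
  rw [← LinearMap.ker_eq_bot, LinearMap.ker_eq_bot']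
  suffices h : ∀ d (v : ℕ → N), ∑ k ∈ Finset.range d, D k (v k).1 = 0 → ∀ k < d, v k = 0 by
    intro f hf
    obtain ⟨d, hd⟩ := f.support.exists_nat_subset_range
    have h1 : ∑ k ∈ Finset.range d, D k (f k).1 = 0 := by
      rw [← hf, Finsupp.lsum_apply, Finsupp.sum_of_support_subset _ hd _ (by simp)]
      rfl
    ext1 k
    by_cases hk : k < d
    · exact h d f h1 k hk
    · by_contra hne
      exact hk (Finset.mem_range.1 (hd (Finsupp.mem_support_iff.2 hne)))
  intro d
  induction d with
  | zero => intro v _ k hk; omega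
  | succ d ih =>
    intro v hv
    -- Applying `x - c` kills the `D_0` term and shifts the rest down, leaving a shorter relation.
    have h1 := congrArg (x - algebraMap K (Module.End K V) c) hv
    rw [Finset.sum_range_succ', map_add, hk0, add_zero, map_sum, map_zero] at h1
    simp only [hks, Finset.sum_neg_distrib, neg_eq_zero] at h1
    have h2 := ih (fun k => v (k + 1)) h1
    have h3 : v 0 = 0 := by
      rw [Finset.sum_range_succ', Finset.sum_eq_zero, zero_add, h0] at hv
      · exact Subtype.ext hv
      · intro k hk
        rw [h2 k (Finset.mem_range.1 hk)]
        simp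
    intro k hk
    cases k with
    | zero => exact h3
    | succ k => exact h2 k (by omega)

/-- Growth of an action with a kernel vector of the last variable, from the growth of the action of
the other variables on the kernel. -/
theorem growth_step_of_ker {K V : Type*} [Field K] [AddCommGroup V] [Module K V] {n : ℕ}
    {T : Fin (n + 1) × Option ℕ → Module.End K V} {N : Submodule K V}
    (hN : Function.Injective (Finsupp.lsum K fun k => (T (Fin.last n, some k)).comp N.subtype))
    {T' : Fin n × Option ℕ → Module.End K N} (hT' : ∀ j v, (T' j v : V) = initOps T j v.1)
    (m : N) {e : ℕ}
    (h : ∀ i, HasIndep K (reachSpan T' m (i + e)) ((i + n).choose n)) (i : ℕ) :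
    HasIndep K (reachSpan T m.1 (i + e)) ((i + (n + 1)).choose (n + 1)) := by
  -- The bases of different levels must be jointly independent, since level `i - k` is paired with
  -- `D_k` for every `k` at once.
  obtain ⟨B, hBS, hSB, hB⟩ := exists_adapted_basis (K := K)
    (fun i => reachSet (fun j => T' j) opWeight m (i + e))
    (fun i j hij => reachSet_mono (by omega))
  have hb : ∀ k : Fin (i + 1), ∃ b : Fin ((i - k + n).choose n) → _,
      Function.Injective b ∧ ∀ a, b a ∈ B (i - k) := fun k => by
    obtain ⟨w, hw, hwS⟩ := h (i - k)
    exact exists_injective_of_span (hSB _) (hB.mono (Set.subset_iUnion B _)) hw hwS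
  choose b hb1 hb2 using hb
  have h1 : LinearIndependent K (fun p : Σ _ : ℕ, (⋃ i, B i : Set _) =>
      Finsupp.single p.1 (p.2 : N)) :=
    Finsupp.linearIndependent_single (R := K) (M := N) (φ := fun _ : ℕ => (⋃ i, B i : Set N))
      (fun _ x => (x : N)) fun _ => hB
  have h2 := h1.map' _ (LinearMap.ker_eq_bot.2 hN)
  refine hasIndep_of_sigma
    (fun p => T (Fin.last n, some p.1.1) (b p.1 p.2).1) ?_ ?_
  · have h3 := h2.comp (fun p : Σ k : Fin (i + 1), Fin ((i - k + n).choose n) =>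
      (⟨p.1.1, b p.1 p.2, Set.mem_iUnion_of_mem _ (hb2 p.1 p.2)⟩ : Σ _ : ℕ, (⋃ i, B i : Set _))) ?_
    · simpa [Function.comp_def] using h3
    · rintro ⟨k, a⟩ ⟨k', a'⟩ hp
      simp only [Sigma.mk.injEq] at hp
      obtain ⟨hk, hp⟩ := hp
      obtain rfl := Fin.ext hk
      have := hb1 k (congrArg Subtype.val (eq_of_heq hp))
      rw [this]
  · rintro ⟨k, a⟩
    refine Submodule.subset_span ?_
    have h3 : Reach _ _ _ _ _ := hBS _ (hb2 k a)
    have h4 := h3.map (U := fun j => T j) (wu := opWeight) Subtype.val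
      (fun j => (j.1.castSucc, j.2)) (fun j v => hT' j v) (fun j => rfl)
    refine Reach.step (Fin.last n, some k.1) h4 ?_
    have := k.2
    simp only [opWeight, Option.elim, id]
    omega

/-- Growth over `K` from the growth after extension of scalars from `K[X]` to a field, where `X`
acts by the last variable. -/
theorem growth_step_of_map {K V : Type*} [Field K] [AddCommGroup V] [Module K V] [Module K[X] V]
    [IsScalarTower K K[X] V] {n : ℕ}
    {T : Fin (n + 1) × Option ℕ → Module.End K V}
    (hX : ∀ v, T (Fin.last n, none) v = (X : K[X]) • v)
    {Ω U : Type*} [Field Ω] [AddCommGroup U] [Module Ω U] [Algebra K[X] Ω] [FaithfulSMul K[X] Ω]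
    [Module K[X] U] [IsScalarTower K[X] Ω U]
    {T' : Fin n × Option ℕ → Module.End Ω U} (φ : V →ₗ[K[X]] U)
    (hφ : ∀ j v, φ (initOps T j v) = T' j (φ v)) (m : V) {e : ℕ}
    (h : ∀ i, HasIndep Ω (reachSpan T' (φ m) (i + e)) ((i + n).choose n)) (i : ℕ) :
    HasIndep K (reachSpan T m (i + e)) ((i + (n + 1)).choose (n + 1)) := by
  obtain ⟨B, hBS, hSB, hB⟩ := exists_adapted_basis (K := Ω)
    (fun i => reachSet (fun j => T' j) opWeight (φ m) (i + e))
    (fun i j hij => reachSet_mono (by omega))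
  have hb : ∀ k : Fin (i + 1), ∃ b : Fin ((i - k + n).choose n) → _,
      Function.Injective b ∧ ∀ a, b a ∈ B (i - k) := fun k => by
    obtain ⟨w, hw, hwS⟩ := h (i - k)
    exact exists_injective_of_span (hSB _) (hB.mono (Set.subset_iUnion B _)) hw hwS
  choose b hb1 hb2 using hb
  have hv : ∀ (k : Fin (i + 1)) a, ∃ v, Reach (fun j v => initOps T j v) opWeight m (i - k + e) v ∧ φ v = b k a :=
    fun k a => Reach.exists_lift (T := fun j v => initOps T j v) φ hφ (hBS _ (hb2 k a))
  choose v hv1 hv2 using hv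
  let : Module K U := Module.compHom U (algebraMap K K[X])
  have : IsScalarTower K K[X] U := IsScalarTower.of_algebraMap_smul fun _ _ => rfl
  -- Independence over `Ω` restricts to `K[X]`; multiplying by the `K`-basis of monomials gives
  -- independence over `K`.
  have h1 : LinearIndependent K[X] (fun x : (⋃ i, B i : Set U) => (x : U)) :=
    LinearIndependent.restrict_scalars (R := K[X]) (K := Ω) (by
      intro f g hfg
      simpa [Algebra.smul_def] using hfg) hB
  have h2 := linearIndependent_smul (basisMonomials K).linearIndependent h1
  refine hasIndep_of_sigma
    (fun p => (monomial p.1.1 (1 : K)) • (v p.1 p.2)) ?_ ?_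
  · refine LinearIndependent.of_comp (φ.restrictScalars K) ?_
    have h3 := h2.comp (fun p : Σ k : Fin (i + 1), Fin ((i - k + n).choose n) =>
      ((p.1.1, ⟨b p.1 p.2, Set.mem_iUnion_of_mem _ (hb2 p.1 p.2)⟩) : ℕ × (⋃ i, B i : Set _))) ?_
    · simpa [Function.comp_def, hv2] using h3
    · rintro ⟨k, a⟩ ⟨k', a'⟩ hp
      simp only [Prod.mk.injEq, Subtype.mk.injEq] at hp
      obtain ⟨hk, hp⟩ := hp
      obtain rfl := Fin.ext hk
      rw [hb1 k hp]
  · rintro ⟨k, a⟩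
    refine Submodule.subset_span ?_
    have h4 := (hv1 k a).map (U := fun j => T j) (wu := opWeight) id
      (fun j : Fin n × Option ℕ => (j.1.castSucc, j.2)) (fun j v => rfl) (fun j => rfl)
    have h5 : ∀ r, Reach (fun j => T j) opWeight m (i - k + e + r)
        ((monomial r (1 : K)) • (v k a)) := by
      intro r
      induction r with
      | zero => simpa using h4
      | succ r ih =>
        have : (monomial (r + 1) (1 : K)) • (v k a) =
            T (Fin.last n, none) ((monomial r (1 : K)) • (v k a)) := by
          rw [hX, smul_smul, X_mul_monomial]
        rw [this]
        exact .step _ ih le_rfl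
    refine (h5 k).mono ?_
    have := k.2
    omega

end PolyDiffOp

end

noncomputable section

namespace PolyDiffOp

open Polynomial TensorProduct

universe u v

/-! ### Bernstein's inequality by induction on the number of variables -/

theorem HasIndep.mono {K V : Type*} [Field K] [AddCommGroup V] [Module K V] {W W' : Submodule K V}
    {N : ℕ} (h : HasIndep K W N) (hW : W ≤ W') : HasIndep K W' N := by
  obtain ⟨w, h1, h2⟩ := h
  exact ⟨w, h1, fun a => hW (h2 a)⟩

theorem reachSpan_le_of_mem {K V : Type*} [Field K] [AddCommGroup V] [Module K V] {n : ℕ}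
    {T : Fin n × Option ℕ → Module.End K V} {m m' : V} {e : ℕ} (h : m' ∈ reachSpan T m e) (i : ℕ) :
    reachSpan T m' i ≤ reachSpan T m (i + e) := fun _ hv => mem_span_reachSet_trans h hv

theorem aeval_mem_reachSpan {K V : Type*} [Field K] [AddCommGroup V] [Module K V] {n : ℕ}
    (T : Fin n × Option ℕ → Module.End K V) (j : Fin n) (m : V) (g : K[X]) :
    aeval (T (j, none)) g m ∈ reachSpan T m g.natDegree := by
  have h : ∀ r, Reach (fun j => T j) opWeight m r ((T (j, none) ^ r) m) := by
    intro r
    induction r with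
    | zero => exact .base 0
    | succ r ih =>
      rw [pow_succ', Module.End.mul_apply]
      exact .step (j, none) ih le_rfl
  rw [aeval_eq_sum_range, LinearMap.sum_apply]
  refine sum_mem fun r hr => Submodule.smul_mem _ _ (Submodule.subset_span ?_)
  exact (h r).mono (Nat.lt_succ_iff.1 (Finset.mem_range.1 hr))

/-- A torsion vector over `K[X]` has a multiple that is an eigenvector of `X`. -/
theorem exists_aeval_eigenvector {K V : Type*} [Field K] [IsAlgClosed K] [AddCommGroup V]
    [Module K V] (x : Module.End K V) {m : V} (hm : m ≠ 0) :
    ∀ (d : ℕ) (f : K[X]), f.natDegree = d → f ≠ 0 → aeval x f m = 0 →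
      ∃ (g : K[X]) (c : K), aeval x g m ≠ 0 ∧
        aeval x g m ∈ LinearMap.ker (x - algebraMap K (Module.End K V) c) := by
  intro d
  induction d with
  | zero =>
    intro f hd hf h
    rw [eq_C_of_natDegree_eq_zero hd] at h hf
    simp only [aeval_C, Module.algebraMap_end_apply, smul_eq_zero, hm, or_false] at h
    simp [h] at hf
  | succ d ih =>
    intro f hd hf h
    obtain ⟨c, hc⟩ := IsAlgClosed.exists_root f (by
      rw [degree_eq_natDegree hf, hd]; exact_mod_cast d.succ_ne_zero)
    obtain ⟨g, rfl⟩ := dvd_iff_isRoot.2 hc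
    have hg : g ≠ 0 := right_ne_zero_of_mul hf
    -- With `f = (X - c) g`, either `g` already kills `m` and has smaller degree, or `g m` is the
    -- eigenvector.
    by_cases h0 : aeval x g m = 0
    · refine ih g ?_ hg h0
      rw [natDegree_mul (X_sub_C_ne_zero c) hg, natDegree_X_sub_C] at hd
      omega
    · exact ⟨g, c, h0, by simpa using h⟩

theorem IsDividedPowerAction.initOps {A : Type*} [Semiring A] {n : ℕ}
    {T : Fin (n + 1) × Option ℕ → A} (hT : IsDividedPowerAction T) :
    IsDividedPowerAction (initOps T) where
  commute _ _ a h := hT.commute _ _ a fun h' => h (Fin.castSucc_injective n h')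
  zero _ := hT.zero _
  succ _ k := hT.succ _ k

/-- Identities of operators can be tested after an injective map. Additivity of `f` suffices, so the
scalars may change, here from `K` to `K[X]`. -/
theorem IsDividedPowerAction.of_injective {R S V W : Type*} [CommRing R] [CommRing S]
    [AddCommGroup V] [Module R V] [AddCommGroup W] [Module S W] {n : ℕ}
    {T : Fin n × Option ℕ → Module.End R V} (hT : IsDividedPowerAction T)
    {T' : Fin n × Option ℕ → Module.End S W} (f : W →+ V) (hf : Function.Injective f)
    (h : ∀ j w, f (T' j w) = T j (f w)) : IsDividedPowerAction T' where
  commute i j a hij := by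
    refine LinearMap.ext fun w => hf ?_
    simpa [h] using LinearMap.congr_fun (hT.commute i j a hij) (f w)
  zero i := by
    refine LinearMap.ext fun w => hf ?_
    simpa [h] using LinearMap.congr_fun (hT.zero i) (f w)
  succ i k := by
    refine LinearMap.ext fun w => hf ?_
    simpa [h] using LinearMap.congr_fun (hT.succ i k) (f w)

theorem IsDividedPowerAction.map {A B : Type*} [Semiring A] [Semiring B] {n : ℕ}
    {T : Fin n × Option ℕ → A} (hT : IsDividedPowerAction T) (f : A →+* B) :
    IsDividedPowerAction fun j => f (T j) where
  commute _ _ a hij := (hT.commute _ _ a hij).map f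
  zero i := by rw [hT.zero, map_one]
  succ i k := by rw [← map_mul, hT.succ, map_add, map_mul]

theorem IsDividedPowerAction.baseChange {R V : Type*} (A : Type*) [CommRing R] [CommRing A]
    [Algebra R A] [AddCommGroup V] [Module R V] {n : ℕ} {T : Fin n × Option ℕ → Module.End R V}
    (hT : IsDividedPowerAction T) : IsDividedPowerAction fun j => (T j).baseChange A :=
  hT.map (Module.End.baseChangeHom R A V).toRingHom

/-- The map `R → V`, `r ↦ r • m`, is injective, and flatness keeps it injective after tensoring with
`A`. -/
theorem one_tmul_ne_zero {R V A : Type*} [CommRing R] [CommRing A] [Nontrivial A] [Algebra R A]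
    [Module.Flat R A] [AddCommGroup V] [Module R V] {m : V}
    (hm : ∀ r : R, r • m = 0 → r = 0) : (1 : A) ⊗ₜ[R] m ≠ 0 := by
  intro h
  have hinj : Function.Injective (LinearMap.toSpanSingleton R V m) :=
    (injective_iff_map_eq_zero _).2 hm
  have h1 : (1 : A) ⊗ₜ[R] (1 : R) = 0 :=
    Module.Flat.lTensor_preserves_injective_linearMap (M := A) _ hinj (by simpa using h)
  have h2 := congrArg (TensorProduct.rid R A) h1
  simp at h2

/-- The growth bound in `n` variables over all algebraically closed fields. -/
def GrowthBound (n : ℕ) : Prop :=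
  -- The field varies because the induction replaces `K` by a closure of `K(X)`; the universe of `V`
  -- is stable under the resulting tensor product.
  ∀ (K : Type u) [Field K] [IsAlgClosed K] (V : Type (max u v)) [AddCommGroup V] [Module K V]
    (T : Fin n × Option ℕ → Module.End K V), IsDividedPowerAction T → ∀ m : V, m ≠ 0 →
      ∃ e, ∀ i, HasIndep K (reachSpan T m (i + e)) ((i + n).choose n)

/-- Induction applies to an eigenvector `g(x) m` inside the eigenspace of `x`; returning to `m`
costs a shift by the degree of `g`. -/
theorem growth_of_torsion {n : ℕ} (ih : GrowthBound.{u, v} n) {K : Type u} [Field K]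
    [IsAlgClosed K] {V : Type (max u v)} [AddCommGroup V] [Module K V]
    {T : Fin (n + 1) × Option ℕ → Module.End K V} (hT : IsDividedPowerAction T) {m : V}
    (hm : m ≠ 0) {f : K[X]} (hf : f ≠ 0) (hfm : aeval (T (Fin.last n, none)) f m = 0) :
    ∃ e, ∀ i, HasIndep K (reachSpan T m (i + e)) ((i + (n + 1)).choose (n + 1)) := by
  obtain ⟨g, c, hg, hgc⟩ := exists_aeval_eigenvector _ hm _ f rfl hf hfm
  set N := LinearMap.ker (T (Fin.last n, none) - algebraMap K (Module.End K V) c) with hN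
  have hinj := injective_sum_dividedPowers (D := fun k => T (Fin.last n, some k)) (hT.zero _)
    (hT.succ _) c
  have hst : ∀ j, ∀ v ∈ N, initOps T j v ∈ N := by
    rintro ⟨j, a⟩ v hv
    have h1 := LinearMap.congr_fun
      (hT.commute j.castSucc (Fin.last n) a (Fin.castSucc_lt_last j).ne) v
    rw [hN, LinearMap.mem_ker, LinearMap.sub_apply, sub_eq_zero, Module.algebraMap_end_apply]
      at hv ⊢
    simp only [Module.End.mul_apply] at h1
    change T (Fin.last n, none) (T (j.castSucc, a) v) = c • T (j.castSucc, a) v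
    rw [← h1, hv, map_smul]
  let T' : Fin n × Option ℕ → Module.End K N := fun j => (initOps T j).restrict (hst j)
  have hT' : IsDividedPowerAction T' :=
    hT.initOps.of_injective N.subtype.toAddMonoidHom Subtype.val_injective fun _ _ => rfl
  obtain ⟨e, he⟩ := ih K N T' hT' ⟨_, hgc⟩ fun h => hg (congrArg Subtype.val h)
  refine ⟨e + g.natDegree, fun i => ?_⟩
  rw [← add_assoc]
  exact (growth_step_of_ker hinj (fun _ _ => rfl) ⟨_, hgc⟩ he i).mono
    (reachSpan_le_of_mem (aeval_mem_reachSpan _ _ _ _) _)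

theorem growth_of_torsionFree {n : ℕ} (ih : GrowthBound.{u, v} n) {K : Type u} [Field K]
    {V : Type (max u v)} [AddCommGroup V] [Module K V] [Module K[X] V] [IsScalarTower K K[X] V]
    {T : Fin (n + 1) × Option ℕ → Module.End K V} (hT : IsDividedPowerAction T)
    (hX : ∀ v, T (Fin.last n, none) v = (X : K[X]) • v) {m : V}
    (hm : ∀ f : K[X], f • m = 0 → f = 0) :
    ∃ e, ∀ i, HasIndep K (reachSpan T m (i + e)) ((i + (n + 1)).choose (n + 1)) := by
  -- The operators of the other coordinates commute with `x`, hence survive extension of scalars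
  -- from `K[X]`.
  have hlin : ∀ j (f : K[X]) v, initOps T j (f • v) = f • initOps T j v := by
    rintro ⟨j, a⟩ f
    induction f using Polynomial.induction_on with
    | C c => intro v; rw [← algebraMap_eq, algebraMap_smul, algebraMap_smul, map_smul]
    | add f g hf hg => intro v; rw [add_smul, map_add, hf, hg, add_smul]
    | monomial k c h =>
      intro v
      have h1 := LinearMap.congr_fun
        (hT.commute j.castSucc (Fin.last n) a (Fin.castSucc_lt_last j).ne)
      simp only [Module.End.mul_apply, hX] at h1
      rw [pow_succ, ← mul_assoc, mul_smul, h, mul_smul _ X]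
      exact congrArg _ (h1 v)
  let S : Fin n × Option ℕ → Module.End K[X] V := fun j =>
    { toFun := fun v => initOps T j v
      map_add' := map_add (initOps T j)
      map_smul' := hlin j }
  have hS : IsDividedPowerAction S :=
    hT.initOps.of_injective (AddMonoidHom.id V) Function.injective_id fun _ _ => rfl
  let Ω := AlgebraicClosure (FractionRing K[X])
  have hΩ : FaithfulSMul K[X] Ω := by
    rw [faithfulSMul_iff_algebraMap_injective,
      IsScalarTower.algebraMap_eq K[X] (FractionRing K[X]) Ω]
    exact (algebraMap (FractionRing K[X]) Ω).injective.comp (IsFractionRing.injective K[X] _)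
  obtain ⟨e, he⟩ := ih Ω (Ω ⊗[K[X]] V) _ (hS.baseChange Ω) (1 ⊗ₜ m) (one_tmul_ne_zero hm)
  exact ⟨e, growth_step_of_map hX (TensorProduct.mk K[X] Ω V 1) (fun j v => by
    simp [S]) m he⟩

theorem growthBound (n : ℕ) : GrowthBound.{u, v} n := by
  induction n with
  | zero =>
    intro K _ _ V _ _ T _ m hm
    refine ⟨0, fun i => ?_⟩
    rw [Nat.choose_zero_right]
    exact ⟨fun _ => m, LinearIndependent.of_subsingleton 0 hm,
      fun _ => Submodule.subset_span (.base _)⟩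
  | succ n ih =>
    intro K _ _ V _ _ T hT m hm
    by_cases h : ∃ f : K[X], f ≠ 0 ∧ aeval (T (Fin.last n, none)) f m = 0
    · obtain ⟨f, hf, hfm⟩ := h
      exact growth_of_torsion ih hT hm hf hfm
    · let : Module K[X] V := Module.compHom V (aeval (T (Fin.last n, none))).toRingHom
      have hs : ∀ (f : K[X]) (v : V), f • v = aeval (T (Fin.last n, none)) f v := fun _ _ => rfl
      have : IsScalarTower K K[X] V := IsScalarTower.of_algebraMap_smul fun c v => by
        rw [hs, AlgHom.commutes, Module.algebraMap_end_apply]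
      refine growth_of_torsionFree ih hT (fun v => by rw [hs, aeval_X]) fun f hf => ?_
      by_contra hne
      exact h ⟨f, hne, hf⟩

/-- Every nonzero vector of a divided power action in `n` variables generates a filtered space of
growth at least `i ^ n / n!`. -/
theorem exists_growth {K : Type u} [Field K] {V : Type v} [AddCommGroup V] [Module K V] {n : ℕ}
    {T : Fin n × Option ℕ → Module.End K V} (hT : IsDividedPowerAction T) {m : V} (hm : m ≠ 0) :
    ∃ e, ∀ i, HasIndep K (reachSpan T m (i + e)) ((i + n).choose n) := by
  let Ω := AlgebraicClosure K
  obtain ⟨e, he⟩ := growthBound.{u, v} n Ω (Ω ⊗[K] V) _ (hT.baseChange Ω) (1 ⊗ₜ m)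
    (one_tmul_ne_zero fun r hr => (smul_eq_zero.1 hr).resolve_right hm)
  refine ⟨e, fun i => ?_⟩
  let φ := TensorProduct.mk K Ω V 1
  -- Descent from `Ω` to `K`: a basis made of words applied to `1 ⊗ m` consists of vectors `1 ⊗ v`.
  -- The chain is constant, as one level suffices.
  obtain ⟨B, hBS, hSB, hB⟩ := exists_adapted_basis (K := Ω)
    (fun _ => reachSet (fun j => (T j).baseChange Ω) opWeight (φ m) (i + e)) monotone_const
  obtain ⟨w, hw, hwS⟩ := he i
  obtain ⟨b, hb1, hb2⟩ := exists_injective_of_span (hSB 0) (hB.mono (Set.subset_iUnion B _)) hw hwS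
  have hv : ∀ a, ∃ v, Reach (fun j v => T j v) opWeight m (i + e) v ∧ φ v = b a := fun a =>
    Reach.exists_lift (T := fun j v => T j v) φ (fun j v => by simp [φ]) (hBS _ (hb2 a))
  choose v hv1 hv2 using hv
  refine ⟨v, LinearIndependent.of_comp φ ?_, fun a => Submodule.subset_span (hv1 a)⟩
  have h1 : LinearIndependent K (fun x : (⋃ i, B i : Set (Ω ⊗[K] V)) => (x : Ω ⊗[K] V)) :=
    LinearIndependent.restrict_scalars' (R := K) (K := Ω) hB
  have h2 := h1.comp (fun a => ⟨b a, Set.mem_iUnion_of_mem 0 (hb2 a)⟩)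
    fun a a' h => hb1 (congrArg Subtype.val h)
  simpa [Function.comp_def, hv2] using h2

end PolyDiffOp

end

noncomputable section

namespace PolyDiffOp

/-! ### The canonical filtration is multiplicative -/

section CanonicalFiltration

variable {K : Type*} [Field K] {n : ℕ}

theorem divDeriv_zero : divDeriv K (0 : Fin n →₀ ℕ) = 1 := by
  refine (MvPolynomial.basisMonomials (Fin n) K).ext fun γ => ?_
  rw [MvPolynomial.coe_basisMonomials, divDeriv_monomial]
  simp

theorem divDeriv_mul_divDeriv (γ β : Fin n →₀ ℕ) :
    divDeriv K γ * divDeriv K β =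
      (∏ i, ((γ i + β i).choose (β i) : K)) • divDeriv K (γ + β) := by
  refine (MvPolynomial.basisMonomials (Fin n) K).ext fun δ => ?_
  rw [MvPolynomial.coe_basisMonomials, Module.End.mul_apply, divDeriv_monomial, divDeriv_monomial,
    LinearMap.smul_apply, divDeriv_monomial, MvPolynomial.smul_monomial, tsub_tsub, add_comm β γ,
    one_mul, one_mul, smul_eq_mul, ← Finset.prod_mul_distrib, ← Finset.prod_mul_distrib]
  congr 1
  refine Finset.prod_congr rfl fun i _ => ?_
  have h : (δ i).choose (β i) * (δ i - β i).choose (γ i) =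
      (γ i + β i).choose (β i) * (δ i).choose (γ i + β i) := by
    rw [mul_comm ((γ i + β i).choose (β i)), Nat.choose_mul (by omega), Nat.add_sub_cancel]
  simp only [Finsupp.coe_tsub, Pi.sub_apply, Finsupp.coe_add, Pi.add_apply]
  rw [← Nat.cast_mul, ← Nat.cast_mul, h]

theorem basicOp_zero_zero : basicOp K (0 : Fin n →₀ ℕ) 0 = 1 := by
  refine Subtype.ext ?_
  change LinearMap.mulLeft K (MvPolynomial.monomial 0 1) * divDeriv K 0 = 1
  rw [divDeriv_zero, mul_one]
  exact LinearMap.ext fun x => by simp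

theorem basicOp_mul_basicOp_zero (α α' β : Fin n →₀ ℕ) :
    basicOp K α 0 * basicOp K α' β = basicOp K (α + α') β := by
  refine Subtype.ext ?_
  change LinearMap.mulLeft K (MvPolynomial.monomial α 1) * divDeriv K 0 *
    (LinearMap.mulLeft K (MvPolynomial.monomial α' 1) * divDeriv K β) =
    LinearMap.mulLeft K (MvPolynomial.monomial (α + α') 1) * divDeriv K β
  rw [divDeriv_zero, mul_one, ← mul_assoc]
  congr 1
  refine LinearMap.ext fun x => ?_
  simp only [Module.End.mul_apply, LinearMap.mulLeft_apply, ← mul_assoc,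
    MvPolynomial.monomial_mul, one_mul]

theorem coe_basicOp_zero_left (β : Fin n →₀ ℕ) : (basicOp K 0 β : DP K n).1 = divDeriv K β := by
  change LinearMap.mulLeft K (MvPolynomial.monomial 0 1) * divDeriv K β = _
  refine LinearMap.ext fun x => ?_
  simp

theorem coe_basicOp_single (j : Fin n) : (basicOp K (Finsupp.single j 1) 0 : DP K n).1 =
    LinearMap.mulLeft K (MvPolynomial.X j) := by
  change LinearMap.mulLeft K (MvPolynomial.monomial _ 1) * divDeriv K 0 = _
  rw [divDeriv_zero, mul_one]
  rfl

theorem basicOp_zero_mul_basicOp_zero (γ β : Fin n →₀ ℕ) :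
    basicOp K 0 γ * basicOp K 0 β =
      (∏ i, ((γ i + β i).choose (β i) : K)) • basicOp K 0 (γ + β) := by
  refine Subtype.ext ?_
  change (basicOp K 0 γ : DP K n).1 * (basicOp K 0 β : DP K n).1 =
    (∏ i, ((γ i + β i).choose (β i) : K)) • (basicOp K 0 (γ + β) : DP K n).1
  simp only [coe_basicOp_zero_left, divDeriv_mul_divDeriv]

theorem basicOp_zero_mul_basicOp_single (γ : Fin n →₀ ℕ) (j : Fin n) :
    basicOp K 0 γ * basicOp K (Finsupp.single j 1) 0 =
      basicOp K (Finsupp.single j 1) 0 * basicOp K 0 γ +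
        if γ j = 0 then 0 else basicOp K 0 (γ - Finsupp.single j 1) := by
  refine Subtype.ext ?_
  have h := commMul_X_divDeriv (K := K) j γ
  rw [commMul_apply, sub_eq_iff_eq_add'] at h
  have h1 : ((basicOp K 0 γ * basicOp K (Finsupp.single j 1) 0 : DP K n) : Module.End K _) =
      divDeriv K γ * LinearMap.mulLeft K (MvPolynomial.X j) := by
    rw [← coe_basicOp_zero_left, ← coe_basicOp_single]; rfl
  have h2 : ((basicOp K (Finsupp.single j 1) 0 * basicOp K 0 γ : DP K n) : Module.End K _) =
      LinearMap.mulLeft K (MvPolynomial.X j) * divDeriv K γ := by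
    rw [← coe_basicOp_zero_left, ← coe_basicOp_single]; rfl
  rw [Subalgebra.coe_add, h1, h2, h]
  split_ifs
  · rfl
  · rw [coe_basicOp_zero_left]

theorem basicOp_mem_canonicalFiltration {α β : Fin n →₀ ℕ} {i : ℕ} (h : α.degree + β.degree ≤ i) :
    basicOp K α β ∈ canonicalFiltration K n i := Submodule.subset_span ⟨α, β, h, rfl⟩

theorem canonicalFiltration_mono : Monotone (canonicalFiltration K n) := by
  intro i j hij
  refine Submodule.span_mono ?_
  rintro _ ⟨α, β, h, rfl⟩
  exact ⟨α, β, h.trans hij, rfl⟩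

theorem basicOp_zero_right_mul_mem (α : Fin n →₀ ℕ) {i : ℕ} {d : DP K n}
    (hd : d ∈ canonicalFiltration K n i) :
    basicOp K α 0 * d ∈ canonicalFiltration K n (α.degree + i) := by
  refine Submodule.span_induction ?_ ?_ ?_ ?_ hd
  · rintro _ ⟨α', β, h, rfl⟩
    rw [basicOp_mul_basicOp_zero]
    exact basicOp_mem_canonicalFiltration (by rw [map_add]; omega)
  · rw [mul_zero]; exact zero_mem _
  · intro x y _ _ hx hy
    rw [mul_add]; exact add_mem hx hy
  · intro c x _ hx
    rw [mul_smul_comm]; exact Submodule.smul_mem _ _ hx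

/-- Move one variable `x_j` at a time to the left past the derivative; the commutator term has total
degree two lower. -/
theorem basicOp_zero_left_mul_basicOp_mem (β : Fin n →₀ ℕ) :
    ∀ (k : ℕ) (α γ : Fin n →₀ ℕ), α.degree = k →
      basicOp K 0 γ * basicOp K α β ∈ canonicalFiltration K n (γ.degree + (k + β.degree)) := by
  intro k
  induction k with
  | zero =>
    intro α γ hα
    rw [(Finsupp.degree_eq_zero_iff α).1 hα, basicOp_zero_mul_basicOp_zero]
    exact Submodule.smul_mem _ _ (basicOp_mem_canonicalFiltration (by simp))
  | succ k ih =>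
    intro α γ hα
    obtain ⟨j, hj⟩ : ∃ j, α j ≠ 0 := by
      by_contra! h
      have : α = 0 := Finsupp.ext h
      simp [this] at hα
    have hle : Finsupp.single j 1 ≤ α := Finsupp.single_le_iff.2 (Nat.one_le_iff_ne_zero.2 hj)
    obtain ⟨α', rfl⟩ := exists_add_of_le hle
    rw [map_add, Finsupp.degree_single] at hα
    rw [← basicOp_mul_basicOp_zero, ← mul_assoc, basicOp_zero_mul_basicOp_single, add_mul,
      mul_assoc]
    refine add_mem ?_ ?_
    · refine canonicalFiltration_mono ?_
        (basicOp_zero_right_mul_mem (Finsupp.single j 1) (ih α' γ (by omega)))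
      rw [Finsupp.degree_single]
      omega
    · split_ifs with hγ
      · rw [zero_mul]; exact zero_mem _
      · have hle : Finsupp.single j 1 ≤ γ :=
          Finsupp.single_le_iff.2 (Nat.one_le_iff_ne_zero.2 hγ)
        have hdeg := congrArg Finsupp.degree (tsub_add_cancel_of_le hle)
        rw [map_add, Finsupp.degree_single] at hdeg
        exact canonicalFiltration_mono (by omega) (ih α' (γ - Finsupp.single j 1) (by omega))

theorem mul_mem_canonicalFiltration {i j : ℕ} {a b : DP K n} (ha : a ∈ canonicalFiltration K n i)
    (hb : b ∈ canonicalFiltration K n j) : a * b ∈ canonicalFiltration K n (i + j) := by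
  have h1 : ∀ γ : Fin n →₀ ℕ, basicOp K 0 γ * b ∈ canonicalFiltration K n (γ.degree + j) := by
    intro γ
    refine Submodule.span_induction ?_ ?_ ?_ ?_ hb
    · rintro _ ⟨α, β, h, rfl⟩
      exact canonicalFiltration_mono (by omega) (basicOp_zero_left_mul_basicOp_mem β _ α γ rfl)
    · rw [mul_zero]; exact zero_mem _
    · intro x y _ _ hx hy
      rw [mul_add]; exact add_mem hx hy
    · intro c x _ hx
      rw [mul_smul_comm]; exact Submodule.smul_mem _ _ hx
  refine Submodule.span_induction ?_ ?_ ?_ ?_ ha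
  · rintro _ ⟨α, β, h, rfl⟩
    have h2 := basicOp_mul_basicOp_zero (K := K) α 0 β
    rw [add_zero] at h2
    rw [← h2, mul_assoc]
    exact canonicalFiltration_mono (by omega) (basicOp_zero_right_mul_mem α (h1 β))
  · rw [zero_mul]; exact zero_mem _
  · intro x y _ _ hx hy
    rw [add_mul]; exact add_mem hx hy
  · intro c x _ hx
    rw [smul_mul_assoc]; exact Submodule.smul_mem _ _ hx

theorem one_mem_canonicalFiltration (i : ℕ) : (1 : DP K n) ∈ canonicalFiltration K n i := by
  rw [← basicOp_zero_zero]
  exact basicOp_mem_canonicalFiltration (by simp)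

variable (K n) in
/-- The variables and the divided powers of the partial derivatives as elements of `D(P_n)`. -/
def generatorOp (j : Fin n × Option ℕ) : DP K n :=
  j.2.elim (basicOp K (Finsupp.single j.1 1) 0) fun k => basicOp K 0 (Finsupp.single j.1 k)

theorem generatorOp_mem (j : Fin n × Option ℕ) :
    generatorOp K n j ∈ canonicalFiltration K n (opWeight j) := by
  obtain ⟨j, _ | k⟩ := j
  · exact basicOp_mem_canonicalFiltration (by simp [opWeight])
  · exact basicOp_mem_canonicalFiltration (by simp [opWeight])

theorem isDividedPowerAction_generatorOp : IsDividedPowerAction (generatorOp K n) where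
  commute i j a hij := by
    cases a with
    | none =>
      change _ * _ = _ * _
      simp [generatorOp, basicOp_mul_basicOp_zero, add_comm]
    | some k =>
      change basicOp K 0 (Finsupp.single i k) * basicOp K (Finsupp.single j 1) 0 = _
      rw [basicOp_zero_mul_basicOp_single, if_pos (by simp [hij]), add_zero]
      rfl
  zero i := by simp [generatorOp, basicOp_zero_zero]
  succ i k := by
    have h := basicOp_zero_mul_basicOp_single (K := K) (Finsupp.single i (k + 1)) i
    rwa [if_neg (by simp), ← Finsupp.single_tsub, Nat.add_sub_cancel] at h

/-- A multiplicative filtration of an algebra adapted to a system of divided power operators. -/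
structure IsDividedPowerFiltration {K A : Type*} [Field K] [Ring A] [Algebra K A] {n : ℕ}
    (T : Fin n × Option ℕ → A) (G : ℕ → Submodule K A) : Prop where
  action : IsDividedPowerAction T
  mono : Monotone G
  one_mem : ∀ i, 1 ∈ G i
  mul_mem : ∀ {i j a b}, a ∈ G i → b ∈ G j → a * b ∈ G (i + j)
  operator_mem : ∀ j, T j ∈ G (opWeight j)

theorem isDividedPowerFiltration_canonicalFiltration :
    IsDividedPowerFiltration (A := DP K n) (generatorOp K n) (canonicalFiltration K n) where
  action := isDividedPowerAction_generatorOp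
  mono := canonicalFiltration_mono
  one_mem := one_mem_canonicalFiltration
  mul_mem := mul_mem_canonicalFiltration
  operator_mem := generatorOp_mem

end CanonicalFiltration

/-! ### Growth of modules and chains of submodules -/

section Module

variable {K A M : Type*} [Field K] [Ring A] [Algebra K A] [AddCommGroup M] [Module K M]
  [Module A M] [IsScalarTower K A M] {n : ℕ} {T : Fin n × Option ℕ → A} {G : ℕ → Submodule K A}

/-- A word of weight at most `i` acts as one element of `G i`, by multiplicativity. -/
theorem reachSpan_lsmul_le (hG : IsDividedPowerFiltration T G) (m : M) (i : ℕ) :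
    reachSpan (fun j => Algebra.lsmul K K M (T j)) m i ≤
      (G i).map ((Algebra.lsmul K K M).toLinearMap.flip m) := by
  refine Submodule.span_le.2 fun v hv => ?_
  change Reach _ _ _ _ _ at hv
  induction hv with
  | base i => exact ⟨1, hG.one_mem i, by simp⟩
  | step j _ hj ih =>
    obtain ⟨a, ha, rfl⟩ := ih
    refine ⟨T j * a, hG.mono (by omega) (hG.mul_mem (hG.operator_mem j) ha), ?_⟩
    simp

/-- Bernstein's inequality: a nonzero vector generates a module of growth at least `i ^ n / n!`. -/
theorem exists_linearIndependent_smul (hG : IsDividedPowerFiltration T G) {m : M} (hm : m ≠ 0) :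
    ∃ e, ∀ i, ∃ a : Fin ((i + n).choose n) → A,
      (∀ k, a k ∈ G (i + e)) ∧ LinearIndependent K fun k => a k • m := by
  obtain ⟨e, he⟩ := exists_growth (hG.action.map (Algebra.lsmul K K M).toRingHom) hm
  refine ⟨e, fun i => ?_⟩
  obtain ⟨w, hw, hwS⟩ := he i
  choose a ha hav using fun k => reachSpan_lsmul_le hG m _ (hwS k)
  refine ⟨a, ha, ?_⟩
  have : (fun k => a k • m) = w := funext fun k => hav k
  rwa [this]

theorem exists_linearIndependent_mkQ (hG : IsDividedPowerFiltration T G) {N : Submodule A M}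
    {m : M} (hm : m ∉ N) :
    ∃ e, ∀ i, ∃ a : Fin ((i + n).choose n) → A, (∀ k, a k ∈ G (i + e)) ∧
      LinearIndependent K fun k => N.mkQ (a k • m) := by
  have hne : N.mkQ m ≠ 0 := fun h => hm ((Submodule.Quotient.mk_eq_zero N).1 h)
  obtain ⟨e, he⟩ := exists_linearIndependent_smul hG hne
  refine ⟨e, fun i => ?_⟩
  obtain ⟨a, ha, hli⟩ := he i
  refine ⟨a, ha, ?_⟩
  simpa only [map_smul] using hli

theorem smul_mem_moduleFiltration (hG : IsDividedPowerFiltration T G) (M₀ : Submodule K M)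
    {i j : ℕ} {a : A} (ha : a ∈ G i) {v : M} (hv : v ∈ moduleFiltration G M₀ j) :
    a • v ∈ moduleFiltration G M₀ (i + j) := by
  refine Submodule.span_induction ?_ ?_ ?_ ?_ hv
  · rintro _ ⟨b, hb, m, hm, rfl⟩
    exact Submodule.subset_span ⟨a * b, hG.mul_mem ha hb, m, hm, smul_smul _ _ _⟩
  · rw [smul_zero]; exact zero_mem _
  · intro x y _ _ hx hy
    rw [smul_add]; exact add_mem hx hy
  · intro c x _ hx
    rw [smul_comm]; exact Submodule.smul_mem _ _ hx

theorem moduleFiltration_le {A M : Type*} [Ring A] [Algebra K A] [AddCommGroup M] [Module K M]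
    [Module A M] {F G : ℕ → Submodule K A} {i j : ℕ} (h : F i ≤ G j) (M₀ : Submodule K M) :
    moduleFiltration F M₀ i ≤ moduleFiltration G M₀ j := by
  refine Submodule.span_mono ?_
  rintro _ ⟨a, ha, m, hm, rfl⟩
  exact ⟨a, h ha, m, hm, rfl⟩

theorem exists_mem_moduleFiltration (hG : IsDividedPowerFiltration T G)
    (hex : ∀ a : A, ∃ i, a ∈ G i) {M₀ : Submodule K M}
    (hM₀ : Submodule.span A (M₀ : Set M) = ⊤) (m : M) : ∃ i, m ∈ moduleFiltration G M₀ i := by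
  have hm : m ∈ Submodule.span A (M₀ : Set M) := hM₀ ▸ Submodule.mem_top
  refine Submodule.span_induction ?_ ?_ ?_ ?_ hm
  · intro x hx
    exact ⟨0, Submodule.subset_span ⟨1, hG.one_mem 0, x, hx, (one_smul _ x).symm⟩⟩
  · exact ⟨0, zero_mem _⟩
  · rintro x y _ _ ⟨i, hi⟩ ⟨j, hj⟩
    exact ⟨i + j, add_mem (moduleFiltration_le (hG.mono (Nat.le_add_right i j)) M₀ hi)
      (moduleFiltration_le (hG.mono (Nat.le_add_left j i)) M₀ hj)⟩
  · rintro a x _ ⟨i, hi⟩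
    obtain ⟨j, hj⟩ := hex a
    exact ⟨j + i, smul_mem_moduleFiltration hG M₀ hj hi⟩

/-- Vectors in the steps of a chain that are independent modulo the previous steps are
independent. -/
theorem linearIndependent_of_chain {K M : Type*} [Field K] [AddCommGroup M] [Module K M] {r : ℕ} {ι : Type*} [Fintype ι] {Q : Fin r → Type*}
    [∀ j, AddCommGroup (Q j)] [∀ j, Module K (Q j)] (q : ∀ j, M →ₗ[K] Q j) {v : Fin r → ι → M}
    (hlt : ∀ i j, i < j → ∀ k, q j (v i k) = 0)
    (hv : ∀ j, LinearIndependent K fun k => q j (v j k)) :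
    LinearIndependent K fun p : Fin r × ι => v p.1 p.2 := by
  rw [Fintype.linearIndependent_iff]
  intro g hg
  suffices h : ∀ j k, g (j, k) = 0 from fun p => h p.1 p.2
  intro j
  -- Descending induction: `q j` kills the vectors of lower index, and the coefficients of higher
  -- index are already zero.
  induction j using WellFoundedGT.induction with
  | ind j ih =>
    have h1 := congrArg (q j) hg
    rw [Fintype.sum_prod_type, map_sum, map_zero, Finset.sum_eq_single j] at h1
    · simp only [map_sum, map_smul] at h1
      exact Fintype.linearIndependent_iff.1 (hv j) _ h1
    · intro i _ hij
      rw [map_sum]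
      refine Finset.sum_eq_zero fun k _ => ?_
      rcases lt_or_gt_of_ne hij with h | h
      · rw [map_smul, hlt i j h, smul_zero]
      · rw [ih i h, zero_smul, map_zero]
    · simp

/-- A chain of submodules of length `r` forces a growth of at least `r i ^ n / n!`. -/
theorem hasIndep_of_ltSeries (hG : IsDividedPowerFiltration T G)
    (hex : ∀ a : A, ∃ i, a ∈ G i)
    {M₀ : Submodule K M} (hM₀ : Submodule.span A (M₀ : Set M) = ⊤)
    (s : LTSeries (Submodule A M)) :
    ∃ e, ∀ i, HasIndep K (moduleFiltration G M₀ (i + e))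
      (s.length * (i + n).choose n) := by
  have hm : ∀ j : Fin s.length, ∃ m ∈ s j.succ, m ∉ s j.castSucc := fun j =>
    SetLike.exists_of_lt (s.step j)
  choose m hm1 hm2 using hm
  choose e he using fun j => exists_linearIndependent_mkQ hG (hm2 j)
  choose d hd using fun j => exists_mem_moduleFiltration hG hex hM₀ (m j)
  -- The sum bounds every individual shift: `e j` from the growth of `m j`, `d j` from its position
  -- in the filtration.
  refine ⟨∑ j, (e j + d j), fun i => ?_⟩
  choose a ha1 ha2 using fun j => he j i
  have hli := linearIndependent_of_chain (fun j => (s j.castSucc).mkQ.restrictScalars K)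
    (v := fun j k => a j k • m j) (fun i j hij k => by
      have : s i.succ ≤ s j.castSucc := s.monotone (Fin.succ_le_castSucc_iff.2 hij)
      exact (Submodule.Quotient.mk_eq_zero _).2 (Submodule.smul_mem _ _ (this (hm1 i)))) ha2
  let ε := (Fintype.equivFinOfCardEq (α := Fin s.length × Fin ((i + n).choose n))
    (n := s.length * (i + n).choose n) (by simp)).symm
  refine ⟨_, hli.comp ε ε.injective, fun k => ?_⟩
  have h1 := Finset.single_le_sum (f := fun j => e j + d j) (fun _ _ => Nat.zero_le _)
    (Finset.mem_univ (ε k).1)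
  exact moduleFiltration_le (hG.mono (by simp only at h1; omega)) M₀
    (smul_mem_moduleFiltration hG M₀ (ha1 (ε k).1 (ε k).2) (hd (ε k).1))

end Module

end PolyDiffOp

end

noncomputable section

namespace PolyDiffOp

open Filter Topology

/-! ### Comparison of leading coefficients -/

theorem HasIndep.le_finrank {K V : Type*} [Field K] [AddCommGroup V] [Module K V]
    {W : Submodule K V} {N : ℕ} (h : HasIndep K W N) [Module.Finite K W] :
    N ≤ Module.finrank K W := by
  obtain ⟨w, hw, hwW⟩ := h
  have h1 : LinearIndependent K fun a => (⟨w a, hwW a⟩ : W) :=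
    LinearIndependent.of_comp W.subtype hw
  simpa using h1.fintype_card_le_finrank

/-- Needed because `finrank` is zero by default in infinite dimension, where it would not bound
independent families. -/
theorem finite_moduleFiltration {K A M : Type*} [Field K] [Ring A] [Algebra K A] [AddCommGroup M]
    [Module K M] [Module A M] [IsScalarTower K A M] {F : ℕ → Submodule K A} {i : ℕ}
    (hF : Module.Finite K (F i)) {M₀ : Submodule K M} (hM₀ : Module.Finite K M₀) :
    Module.Finite K (moduleFiltration F M₀ i) := by
  have h : moduleFiltration F M₀ i ≤
      Submodule.map₂ (Algebra.lsmul K K M).toLinearMap (F i) M₀ := by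
    refine Submodule.span_le.2 ?_
    rintro _ ⟨a, ha, m, hm, rfl⟩
    exact Submodule.apply_mem_map₂ (Algebra.lsmul K K M).toLinearMap ha hm
  have hfg : (Submodule.map₂ (Algebra.lsmul K K M).toLinearMap (F i) M₀).FG :=
    (Submodule.fg_iff_finiteDimensional _ |>.2 hF).map₂ _
      (Submodule.fg_iff_finiteDimensional _ |>.2 hM₀)
  have := (Submodule.fg_iff_finiteDimensional _).1 hfg
  exact Submodule.finiteDimensional_of_le h

/-- Comparison of leading coefficients. -/
theorem le_of_hasLeadingBound {f : ℕ → ℕ} {n : ℕ} {l : ℝ} (hf : HasLeadingBound f n l)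
    {r c d : ℕ} (hc : 0 < c) (h : ∀ᶠ i in atTop, r * (i + n).choose n ≤ f (c * i + d)) :
    (r : ℝ) ≤ n.factorial * (l * (c : ℝ) ^ n) := by
  obtain ⟨g, hg, hfg⟩ := hf
  have hy : Tendsto (fun i : ℕ => c * i + d) atTop atTop :=
    tendsto_atTop_mono (fun i => (Nat.le_mul_of_pos_left i hc).trans (Nat.le_add_right _ _)) tendsto_id
  have hratio : Tendsto (fun i : ℕ => ((c * i + d : ℕ) : ℝ) / i) atTop (𝓝 c) := by
    have h1 : Tendsto (fun i : ℕ => (c : ℝ) + d / i) atTop (𝓝 (c + 0)) :=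
      tendsto_const_nhds.add (tendsto_const_div_atTop_nhds_zero_nat _)
    rw [add_zero] at h1
    refine h1.congr' ?_
    filter_upwards [eventually_gt_atTop 0] with i hi
    have : (i : ℝ) ≠ 0 := by positivity
    push_cast
    field_simp
  -- This is the upper bound at `c * i + d` divided by `i ^ n`; the lower bound divided by `i ^ n`
  -- is at least `r / n!`.
  have hlim : Tendsto (fun i : ℕ => (l + g (c * i + d) / ((c * i + d : ℕ) : ℝ) ^ n) *
      (((c * i + d : ℕ) : ℝ) / i) ^ n) atTop (𝓝 ((l + 0) * (c : ℝ) ^ n)) :=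
    (tendsto_const_nhds.add (hg.tendsto_div_nhds_zero.comp hy)).mul (hratio.pow n)
  rw [add_zero] at hlim
  have hle : (r : ℝ) / n.factorial ≤ l * (c : ℝ) ^ n := by
    refine ge_of_tendsto hlim ?_
    filter_upwards [h, hy.eventually hfg, eventually_gt_atTop 0] with i h1 h2 hi
    have hi' : (0 : ℝ) < i := by exact_mod_cast hi
    have hyi : (0 : ℝ) < ((c * i + d : ℕ) : ℝ) := by exact_mod_cast (by positivity)
    have h3 : (i : ℝ) ^ n / n.factorial ≤ ((i + n).choose n : ℝ) := by
      refine le_trans ?_ (Nat.pow_le_choose n (i + n))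
      gcongr
      exact_mod_cast (by omega)
    have h4 : (r : ℝ) * ((i + n).choose n : ℝ) ≤ f (c * i + d) := by exact_mod_cast h1
    have h5 : (r : ℝ) * ((i : ℝ) ^ n / n.factorial) ≤
        l * ((c * i + d : ℕ) : ℝ) ^ n + g (c * i + d) :=
      (mul_le_mul_of_nonneg_left h3 (Nat.cast_nonneg r)).trans (h4.trans h2)
    have h6 : (l + g (c * i + d) / ((c * i + d : ℕ) : ℝ) ^ n) * (((c * i + d : ℕ) : ℝ) / i) ^ n =
        (l * ((c * i + d : ℕ) : ℝ) ^ n + g (c * i + d)) / (i : ℝ) ^ n := by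
      rw [div_pow]
      field_simp
    rw [h6, le_div_iff₀ (by positivity)]
    calc (r : ℝ) / n.factorial * (i : ℝ) ^ n = r * ((i : ℝ) ^ n / n.factorial) := by ring
      _ ≤ _ := h5
  rwa [div_le_iff₀ (by positivity), mul_comm] at hle

/-- A polynomial of degree `n` is `O(i ^ n)`; the implied constant serves as `l`, with zero error
term. -/
theorem hasLeadingBound_of_polynomial {f : ℕ → ℕ} {n : ℕ} {q : Polynomial ℚ}
    (hq : q.natDegree = n) (h : ∀ᶠ i : ℕ in atTop, (f i : ℚ) ≤ q.eval (i : ℚ)) :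
    ∃ l, HasLeadingBound f n l := by
  have h1 : (fun x => q.eval x) =O[atTop] fun x => (Polynomial.X ^ n : Polynomial ℚ).eval x :=
    Polynomial.isBigO_atTop_of_degree_le q _ (by
      rw [Polynomial.degree_X_pow, ← hq]
      exact Polynomial.degree_le_natDegree)
  have h2 := h1.comp_tendsto (tendsto_natCast_atTop_atTop (R := ℚ))
  obtain ⟨C, hC⟩ := h2.bound
  refine ⟨C, 0, Asymptotics.isLittleO_zero _ _, ?_⟩
  filter_upwards [h, hC] with i hi hCi
  simp only [Function.comp_apply, Polynomial.eval_pow, Polynomial.eval_X] at hCi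
  have h3 : (f i : ℝ) ≤ ((q.eval (i : ℚ) : ℚ) : ℝ) := by exact_mod_cast hi
  have h4 : ((q.eval (i : ℚ) : ℚ) : ℝ) ≤ ‖q.eval (i : ℚ)‖ := by
    rw [← Rat.norm_cast_real, Real.norm_eq_abs]
    exact le_abs_self _
  have h5 : ‖((i : ℚ) ^ n)‖ = (i : ℝ) ^ n := by
    rw [← Rat.norm_cast_real]
    simp
  rw [h5] at hCi
  simpa using h3.trans (h4.trans hCi)

/-- The multiplicity bound for the length of chains of submodules. -/
theorem ltSeries_length_le {K A M : Type*} [Field K] [Ring A] [Algebra K A] [AddCommGroup M]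
    [Module K M] [Module A M] [IsScalarTower K A M] {n : ℕ} {T : Fin n × Option ℕ → A}
    {G : ℕ → Submodule K A}
    (hG : IsDividedPowerFiltration T G)
    (hex : ∀ a : A, ∃ i, a ∈ G i)
    {F : ℕ → Submodule K A} (hF : IsFiniteFiltration F) {c d : ℕ}
    (hc : 0 < c) (hle : ∀ᶠ i in atTop, G i ≤ F (c * i + d))
    {M₀ : Submodule K M} (hM₀ : IsFiniteGenerating A M₀) {l : ℝ}
    (hl : HasLeadingBound
      (fun i => Module.finrank K (moduleFiltration F M₀ i)) n l)
    (s : LTSeries (Submodule A M)) :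
    (s.length : ℝ) ≤ n.factorial * (l * (c : ℝ) ^ n) := by
  obtain ⟨e, he⟩ := hasIndep_of_ltSeries hG hex hM₀.2 s
  -- The shift comes from `c * (i + e) + d = c * i + (c * e + d)`.
  refine le_of_hasLeadingBound (d := c * e + d) hl hc ?_
  filter_upwards [(tendsto_add_atTop_nat e).eventually hle] with i hi
  have : Module.Finite K (moduleFiltration F M₀ (c * (i + e) + d)) :=
    finite_moduleFiltration (hF.finite _) hM₀.1
  have h1 := ((he i).mono (moduleFiltration_le hi M₀)).le_finrank
  rwa [mul_add, add_assoc] at h1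

end PolyDiffOp

end

theorem mainTheorem3 {K : Type*} [Field K] (p : ℕ) [Fact p.Prime] [CharP K p] (n : ℕ)
    {M : Type*} [AddCommGroup M] [Module K M] [Module (PolyDiffOp.DP K n) M]
    [IsScalarTower K (PolyDiffOp.DP K n) M] (hM : PolyDiffOp.IsHolonomic K n M) :
    IsFiniteLength (PolyDiffOp.DP K n) M ∧
    ∃ k : ℕ, Module.length (PolyDiffOp.DP K n) M = (k : ℕ∞) ∧
      ∀ F : ℕ → Submodule K (PolyDiffOp.DP K n), PolyDiffOp.IsFiniteFiltration (A := PolyDiffOp.DP K n) F →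
        PolyDiffOp.FiltrationStrongEquiv (A := PolyDiffOp.DP K n) F (PolyDiffOp.canonicalFiltration K n) →
      ∀ M₀ : Submodule K M, PolyDiffOp.IsFiniteGenerating (PolyDiffOp.DP K n) M₀ →
      ∀ l : ℝ,
        PolyDiffOp.HasLeadingBound
          (fun i => Module.finrank K (PolyDiffOp.moduleFiltration (A := PolyDiffOp.DP K n) F M₀ i)) n l →
        (k : ℝ) ≤ (n.factorial : ℝ) * l := by
  obtain ⟨F, M₀, ⟨hF, a, b, c, d, -, hc, heq⟩, hM₀, q, hq, hqF⟩ := hM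
  have hG := PolyDiffOp.isDividedPowerFiltration_canonicalFiltration (K := K) (n := n)
  -- Exhaustiveness of the canonical filtration is inherited from the equivalent filtration `F`.
  have hex : ∀ x : PolyDiffOp.DP K n, ∃ i, x ∈ PolyDiffOp.canonicalFiltration K n i := by
    intro x
    obtain ⟨j, hj⟩ := hF.exhaustive x
    obtain ⟨i, hi, hji⟩ := (heq.and (Filter.eventually_ge_atTop j)).exists
    exact ⟨_, hi.1 (hF.mono hji hj)⟩
  obtain ⟨l, hl⟩ := PolyDiffOp.hasLeadingBound_of_polynomial hq hqF
  have hfin : IsFiniteLength (PolyDiffOp.DP K n) M := by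
    rw [← Module.finiteDimensionalOrder_submodule_iff]
    by_contra hinf
    rw [not_finiteDimensionalOrder_iff] at hinf
    -- Infinite length would give chains of every length, in particular one beyond the multiplicity
    -- bound.
    obtain ⟨r, hr⟩ := exists_nat_gt ((n.factorial : ℝ) * (l * (c : ℝ) ^ n))
    have h := PolyDiffOp.ltSeries_length_le hG hex hF hc (heq.mono fun _ h => h.2) hM₀ hl
      (LTSeries.withLength _ r)
    rw [LTSeries.length_withLength] at h
    exact absurd h (not_le.2 hr)
  refine ⟨hfin, ?_⟩
  have hfd := Module.finiteDimensionalOrder_submodule_iff.2 hfin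
  refine ⟨(LTSeries.longestOf (Submodule (PolyDiffOp.DP K n) M)).length, ?_, ?_⟩
  · rw [← WithBot.coe_inj, Module.coe_length, Order.krullDim_eq_length_of_finiteDimensionalOrder]
    rfl
  · rintro F hF ⟨b, d, heq⟩ M₀ hM₀ l hl
    -- Strong equivalence allows `c = 1`, so the factor `c ^ n` disappears and the bound is exactly
    -- `n! * l`.
    have h := PolyDiffOp.ltSeries_length_le (c := 1) (d := d) hG hex hF one_pos
      (heq.mono fun i h => by rw [one_mul]; exact h.2) hM₀ hl (LTSeries.longestOf _)
    simpa using h
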